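/- All varieties are over $\mathbb{C}$, and $\mathbb{P}^N=\mathbb{P}(V)$ with $\dim V=N+1$. A smooth projective variety of dimension $n$ is a nonempty Zariski closed subset of a projective space (not necessarily irreducible) that is smooth of pure dimension $n$. An embedding $X\hookrightarrow\mathbb{P}^N$ is an isomorphism of $X$ onto a closed subvariety of $\mathbb{P}^N$. For $Y\subset\mathbb{P}^N$ let $T_{y,Y}\subset\mathbb{P}^N$ denote the embedded tangent space at $y$. A smooth $n$-dimensional $Y\subset\mathbb{P}^N$ is \emph{skew} if $T_{x,Y}\cap T_{y,Y}=\emptyset$ for any two distinct points $x,y\in Y$. It is \emph{algebraically skew} if it is skew and its length-two Terracini locus is empty, that is, there is no zero-dimensional subscheme $S\subset Y$ of length $2$ (reduced or not) such that $\dim V(-2S)>(N+1)-2n-2$, where $V(-2S)$ is the space of linear forms on $\mathbb{P}^N$ vanishing on the subscheme $2S\subset Y$ defined by $\mathcal{I}_{S,Y}^2$. Let $$\operatorname{msdim}X:=\min\{N:\text{there exists an algebraically skew embedding }X\hookrightarrow\mathbb{P}^N\}$$ (with $\min\emptyset=\infty$). Let $X$ be a smooth projective variety of dimension $n$. Then $$\operatorname{msdim}X\ge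 3n .$$ Moreover, infinitesimal nonskewness plays no role in this bound: if $X\hookrightarrow\mathbb{P}^N$ is any embedding with skew image, then $N\ge 3n$. -/

import Mathlib

open MvPolynomial LinearAlgebra.Projectivization

noncomputable section

/-- Complex projective space `ℙ^N = ℙ(ℂ^{N+1})`. -/
abbrev ProjSpace (N : ℕ) : Type := ℙ ℂ (Fin (N + 1) → ℂ)

/-- The homogeneous coordinate ring `ℂ[x₀, …, x_N]` of `ℙ^N`. -/
abbrev CoordRing (N : ℕ) : Type := MvPolynomial (Fin (N + 1)) ℂ

/-- The common zero locus in `ℙ^N` of a set of polynomials. It is only used for homogeneous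
polynomials, for which it does not depend on the chosen representatives. -/
def projZeroLocus {N : ℕ} (S : Set (CoordRing N)) : Set (ProjSpace N) :=
  {p | ∀ f ∈ S, eval p.rep f = 0}

/-- A subset of `ℙ^N` is algebraic if it is the zero locus of a set of homogeneous polynomials. -/
def IsProjAlgebraic {N : ℕ} (X : Set (ProjSpace N)) : Prop :=
  ∃ S : Set (CoordRing N), (∀ f ∈ S, ∃ d, f.IsHomogeneous d) ∧ X = projZeroLocus S

theorem isProjAlgebraic_empty {N : ℕ} : IsProjAlgebraic (∅ : Set (ProjSpace N)) := by
  refine ⟨{1}, ?_, ?_⟩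
  · rintro f rfl
    exact ⟨0, isHomogeneous_one _ _⟩
  · ext p
    simp [projZeroLocus]

theorem isProjAlgebraic_sInter {N : ℕ} (A : Set (Set (ProjSpace N)))
    (hA : ∀ X ∈ A, IsProjAlgebraic X) : IsProjAlgebraic (⋂₀ A) := by
  refine ⟨{f | (∃ d, f.IsHomogeneous d) ∧ ∃ X ∈ A, ∀ p ∈ X, eval p.rep f = 0},
    fun f hf => hf.1, ?_⟩
  ext p
  constructor
  · rintro hp f ⟨-, X, hX, hf⟩
    exact hf p (hp X hX)
  · intro hp X hX
    obtain ⟨S, hS, hXS⟩ := hA X hX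
    rw [hXS]
    intro f hf
    refine hp f ⟨hS f hf, X, hX, fun q hq => ?_⟩
    rw [hXS] at hq
    exact hq f hf

theorem isProjAlgebraic_union {N : ℕ} (X Y : Set (ProjSpace N))
    (hX : IsProjAlgebraic X) (hY : IsProjAlgebraic Y) : IsProjAlgebraic (X ∪ Y) := by
  obtain ⟨S, hS, rfl⟩ := hX
  obtain ⟨T, hT, rfl⟩ := hY
  refine ⟨{h | ∃ f ∈ S, ∃ g ∈ T, h = f * g}, ?_, ?_⟩
  · rintro h ⟨f, hf, g, hg, rfl⟩
    obtain ⟨a, ha⟩ := hS f hf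
    obtain ⟨b, hb⟩ := hT g hg
    exact ⟨a + b, ha.mul hb⟩
  · ext p
    constructor
    · rintro (hp | hp) h ⟨f, hf, g, hg, rfl⟩
      · simp [hp f hf]
      · simp [hp g hg]
    · intro hp
      by_contra hcon
      simp only [Set.mem_union, not_or, projZeroLocus, Set.mem_ofPred_eq, not_forall] at hcon
      obtain ⟨⟨f, hf, hf0⟩, g, hg, hg0⟩ := hcon
      have h := hp (f * g) ⟨f, hf, g, hg, rfl⟩
      rw [map_mul] at h
      exact (mul_ne_zero hf0 hg0) h

/-- The Zariski topology on `ℙ^N`: the closed sets are the algebraic sets. Every subset of `ℙ^N`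
carries the induced topology. -/
instance zariskiTopology (N : ℕ) : TopologicalSpace (ProjSpace N) :=
  TopologicalSpace.ofClosed {X | IsProjAlgebraic X} isProjAlgebraic_empty
    (fun A hA => isProjAlgebraic_sInter A hA)
    (fun X hX Y hY => isProjAlgebraic_union X Y hX hY)

/-- The homogeneous ideal `I(X)` of `X ⊆ ℙ^N`, generated by all homogeneous polynomials that
vanish on `X`. -/
def homogVanishingIdeal {N : ℕ} (X : Set (ProjSpace N)) : Ideal (CoordRing N) :=
  Ideal.span {f | (∃ d, f.IsHomogeneous d) ∧ ∀ p ∈ X, eval p.rep f = 0}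

/-- The linear subspace of `ℂ^{N+1}` of all `v` with `∑ i, ∂f/∂xᵢ(p) vᵢ = 0` for every `f ∈ I(X)`.
Its projectivization is the embedded tangent space. -/
def tangentSubmodule {N : ℕ} (X : Set (ProjSpace N)) (p : ProjSpace N) :
    Submodule ℂ (Fin (N + 1) → ℂ) :=
  ⨅ f ∈ homogVanishingIdeal X,
    LinearMap.ker (∑ i, eval p.rep (pderiv i f) • (LinearMap.proj i : (Fin (N + 1) → ℂ) →ₗ[ℂ] ℂ))

/-- The embedded tangent space `T_{p,X} ⊆ ℙ^N`. -/
def embeddedTangentSpace {N : ℕ} (X : Set (ProjSpace N)) (p : ProjSpace N) : Set (ProjSpace N) :=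
  {q | q.submodule ≤ tangentSubmodule X p}

/-- `X ⊆ ℙ^N` is a smooth projective variety of dimension `n`: it is nonempty and Zariski closed,
all of its irreducible components have Krull dimension `n`, and all of its embedded tangent spaces
have projective dimension `n`. (Irreducibility is not required.) -/
structure IsSmoothProjectiveVariety {N : ℕ} (n : ℕ) (X : Set (ProjSpace N)) : Prop where
  nonempty : X.Nonempty
  isClosed : IsClosed X
  dim_component : ∀ Z ∈ irreducibleComponents X, topologicalKrullDim Z = (n : WithBot ℕ∞)
  smooth : ∀ p ∈ X, Module.finrank ℂ (tangentSubmodule X p) = n + 1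

/-- A map from `X ⊆ ℙ^M` to `ℙ^N` is regular if, Zariski locally on `X`, it is given by
homogeneous polynomials `F₀, …, F_N` of the same degree without common zero. -/
def IsRegularMap {M N : ℕ} (X : Set (ProjSpace M)) (φ : X → ProjSpace N) : Prop :=
  ∀ x : X, ∃ U : Set X, IsOpen U ∧ x ∈ U ∧
    ∃ (d : ℕ) (F : Fin (N + 1) → CoordRing M), (∀ i, (F i).IsHomogeneous d) ∧
      ∀ y ∈ U, ∃ h : (fun i => eval (y : ProjSpace M).rep (F i)) ≠ 0,
        φ y = Projectivization.mk ℂ (fun i => eval (y : ProjSpace M).rep (F i)) h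

/-- A map `φ : X → ℙ^N` is an embedding if it is an isomorphism of `X` onto a Zariski closed
subset of `ℙ^N`. -/
structure IsProjEmbedding {M N : ℕ} (X : Set (ProjSpace M)) (φ : X → ProjSpace N) : Prop where
  regular : IsRegularMap X φ
  isClosed_range : IsClosed (Set.range φ)
  exists_inverse : ∃ ψ : Set.range φ → ProjSpace M, IsRegularMap (Set.range φ) ψ ∧
    ∀ x : X, ψ ⟨φ x, Set.mem_range_self x⟩ = x

/-- `X ⊆ ℙ^N` is skew: embedded tangent spaces at distinct points do not meet. -/
def IsSkew {N : ℕ} (X : Set (ProjSpace N)) : Prop :=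
  ∀ x ∈ X, ∀ y ∈ X, x ≠ y → embeddedTangentSpace X x ∩ embeddedTangentSpace X y = ∅

/-- The irrelevant ideal `(x₀, …, x_N)`. -/
def irrelevantIdeal (N : ℕ) : Ideal (CoordRing N) :=
  Ideal.span (Set.range X)

/-- The saturation of an ideal with respect to the irrelevant ideal. For homogeneous `K` it is the
largest ideal defining the same closed subscheme of `ℙ^N` as `K`. -/
def projSaturation {N : ℕ} (K : Ideal (CoordRing N)) : Ideal (CoordRing N) where
  carrier := {f | ∃ k : ℕ, ∀ h ∈ irrelevantIdeal N ^ k, h * f ∈ K}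
  zero_mem' := ⟨0, fun h _ => by simp⟩
  add_mem' := by
    rintro f g ⟨k, hk⟩ ⟨l, hl⟩
    refine ⟨max k l, fun h hh => ?_⟩
    rw [mul_add]
    exact K.add_mem (hk h (Ideal.pow_le_pow_right (le_max_left k l) hh))
      (hl h (Ideal.pow_le_pow_right (le_max_right k l) hh))
  smul_mem' := by
    rintro c f ⟨k, hk⟩
    refine ⟨k, fun h hh => ?_⟩
    rw [smul_eq_mul, mul_left_comm]
    exact K.mul_mem_left c (hk h hh)

/-- The Hilbert function `d ↦ dim (ℂ[x₀, …, x_N] / J)_d`. -/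
def hilbertFunction {N : ℕ} (J : Ideal (CoordRing N)) (d : ℕ) : ℕ :=
  Module.finrank ℂ
    ((homogeneousSubmodule (Fin (N + 1)) ℂ d).map (Ideal.Quotient.mkₐ ℂ J).toLinearMap)

/-- `J` is the saturated homogeneous ideal of a zero-dimensional closed subscheme of length two
of `ℙ^N`; the closed subschemes of `ℙ^N` correspond to the saturated homogeneous ideals. -/
structure IsLengthTwoSubscheme {N : ℕ} (J : Ideal (CoordRing N)) : Prop where
  isHomogeneous : ∀ f ∈ J, ∀ d, homogeneousComponent d f ∈ J
  saturated : projSaturation J = J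
  length_eq_two : ∀ᶠ d in Filter.atTop, hilbertFunction J d = 2

/-- The space `V(-2S)` of linear forms on `ℙ^N` that vanish on the double `2S` in `X` of the
subscheme `S ⊆ X` with ideal `J`, where `2S ⊆ X` is defined by the square of the ideal sheaf of
`S` in `X`. -/
def doubleVanishing {N : ℕ} (X : Set (ProjSpace N)) (J : Ideal (CoordRing N)) :
    Submodule ℂ (CoordRing N) :=
  homogeneousSubmodule (Fin (N + 1)) ℂ 1 ⊓
    (projSaturation (J ^ 2 ⊔ homogVanishingIdeal X)).restrictScalars ℂ

/-- The length two Terracini locus of an `n`-dimensional `X ⊆ ℙ^N`: the length two subschemes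
`S ⊆ X` with `dim V(-2S) > dim V - 2n - 2`, where `V` is the `(N+1)`-dimensional space of linear
forms on `ℙ^N`. -/
def terraciniLocus {N : ℕ} (n : ℕ) (X : Set (ProjSpace N)) : Set (Ideal (CoordRing N)) :=
  {J | IsLengthTwoSubscheme J ∧ homogVanishingIdeal X ≤ J ∧
    (N : ℤ) + 1 - 2 * n - 2 < Module.finrank ℂ (doubleVanishing X J)}

/-- An `n`-dimensional `X ⊆ ℙ^N` is algebraically skew if it is skew and its length two Terracini
locus is empty. The reduced subschemes `S = {x, y}` express skewness, the nonreduced ones exclude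
infinitesimal nonskewness (for a curve: the third osculating spaces are nondegenerate). -/
structure IsAlgebraicallySkew {N : ℕ} (n : ℕ) (X : Set (ProjSpace N)) : Prop where
  isSkew : IsSkew X
  terracini_empty : terraciniLocus n X = ∅

/-- The minimal algebraically skew embedding dimension of an `n`-dimensional `X`, as an infimum
in `ℕ∞`: it is the minimum of the `N` for which an algebraically skew embedding `X ↪ ℙ^N` exists
(and would be `⊤` if there were none). -/
def msdim {M : ℕ} (n : ℕ) (X : Set (ProjSpace M)) : ℕ∞ :=
  sInf {d : ℕ∞ | ∃ (N : ℕ) (φ : X → ProjSpace N), d = N ∧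
    IsProjEmbedding X φ ∧ IsAlgebraicallySkew n (Set.range φ)}

end

/-! Fix a point `p` of the skew image `Y` of dimension `n` in `ℙ^N`. If `N < 2n`, two affine tangent
spaces of dimension `n + 1` must meet, so write `N = 2n + r`. Near `p`, the tangent spaces of `Y`
are the kernels of the Jacobian of `n + r` equations `f_j`. With a basis `b_a` of the affine tangent
space at `p`, the matrix of derivatives of `f_j` along `b_a` has size `(n + 1) × (n + r)`. At `y`
near `p` its rows are dependent exactly when `T_y` meets `T_p`; at `p` it vanishes. Skewness thus
makes the affine line over `p` a component of its degeneracy locus. The Eagon–Northcott bound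
(`Matrix.height_le_of_forall_maximal_minors_mem`) gives this line codimension at most `(n + r) - (n
+ 1) + 1 = r` in the cone over `Y` (`IsSkew.height_le`). A chain of `n + 1` irreducible closed
subsets of `Y` whose smallest member contains `p` makes the codimension at least `n`
(`le_height_of_ltSeries`). Hence `n ≤ r` and `N ≥ 3n`. Only reduced pairs of points enter.
Smoothness is assumed for `X`, so tangent dimensions are first carried to `Y`
(`IsProjEmbedding.finrank_tangentSubmodule_eq`). -/

noncomputable section

/-! ### Heights of primes and determinantal ideals -/

namespace Ideal

variable {A : Type*} [CommRing A]

/-- Chains of primes extend to `A[X]`, and inclusions stay strict because constant coefficients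
recover the original prime. -/
theorem height_le_height_map_polynomialC (𝔭 : Ideal A) [𝔭.IsPrime] :
    𝔭.height ≤ (𝔭.map (Polynomial.C : A →+* Polynomial A)).height := by
  have hprime : ∀ Q : Ideal A, Q.IsPrime →
      (Q.map (Polynomial.C : A →+* Polynomial A)).IsPrime := fun Q hQ => inferInstance
  have hmono : StrictMono fun Q : PrimeSpectrum A =>
      (⟨Q.asIdeal.map Polynomial.C, hprime _ Q.2⟩ : PrimeSpectrum (Polynomial A)) := by
    intro P Q hPQ
    obtain ⟨hle, hnle⟩ := lt_iff_le_not_ge.1 hPQ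
    refine lt_iff_le_not_ge.2 ⟨Ideal.map_mono hle, fun h => hnle fun a ha => ?_⟩
    have := h (Ideal.mem_map_of_mem Polynomial.C ha)
    simpa using (Ideal.mem_map_C_iff.1 this) 0
  have := Order.height_le_height_apply_of_strictMono _ hmono ⟨𝔭, inferInstance⟩
  simpa only [← PrimeSpectrum.height_eq_orderHeight] using this

theorem mem_map_polynomialC_iff_map_eq_zero {𝔭 : Ideal A} {f : Polynomial A} :
    f ∈ 𝔭.map (Polynomial.C : A →+* Polynomial A) ↔
      Polynomial.mapRingHom (Ideal.Quotient.mk 𝔭) f = 0 := by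
  rw [Ideal.mem_map_C_iff, Polynomial.ext_iff]
  simp [Ideal.Quotient.eq_zero_iff_mem]

/-- A prime lying over `P` and strictly below a prime minimal over `P + (x)` equals `P`. -/
theorem eq_of_lt_of_mem_minimalPrimes_sup_span_singleton [IsNoetherianRing A]
    {P Q R : Ideal A} [P.IsPrime] [Q.IsPrime] {x : A} (hPQ : P ≤ Q) (hQR : Q < R)
    (hR : R ∈ (P ⊔ span {x}).minimalPrimes) : P = Q := by
  have : R.IsPrime := hR.1.1
  have hPR : P ≤ R := hPQ.trans hQR.le
  have hk : RingHom.ker (Quotient.mk P) = P := mk_ker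
  have hsurj := Quotient.mk_surjective (I := P)
  have : (Q.map (Quotient.mk P)).IsPrime := map_isPrime_of_surjective hsurj (by rwa [hk])
  have : (R.map (Quotient.mk P)).IsPrime := map_isPrime_of_surjective hsurj (by rwa [hk])
  have hcomap : ∀ {J : Ideal A}, P ≤ J → (J.map (Quotient.mk P)).comap (Quotient.mk P) = J := by
    intro J hJ
    rw [comap_map_of_surjective' _ hsurj, hk, sup_eq_left.2 hJ]
  have hlt : Q.map (Quotient.mk P) < R.map (Quotient.mk P) := by
    refine lt_of_le_of_ne (map_mono hQR.le) fun h => hQR.ne ?_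
    rw [← hcomap hPQ, ← hcomap hPR, h]
  -- Krull's principal ideal theorem in the domain `A ⧸ P`: the image of `R` has height at most one,
  -- so the image of `Q` has height zero.
  have h2 : (Q.map (Quotient.mk P)).height < 1 :=
    lt_of_lt_of_le (height_strict_mono_of_isPrime hlt) (map_height_le_one_of_mem_minimalPrimes hR)
  have h3 : Q.map (Quotient.mk P) = ⊥ := height_eq_zero_iff_eq_bot.1 (by simpa using h2)
  rw [← hcomap hPQ, h3, ← RingHom.ker_eq_comap_bot, hk]

end Ideal

namespace Matrix

variable {A : Type*} [CommRing A] {k r : ℕ}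

/-- If the minor formed by the first `k` columns and rows does not lie in the prime `P`, then all
maximal minors of a matrix with `k + 1` rows lie in `P` as soon as those containing the first `k`
columns do. -/
theorem det_submatrix_mem_of_bordered_minors_mem {P : Ideal A} [P.IsPrime]
    (M : Matrix (Fin k ⊕ Unit) (Fin k ⊕ Fin r) A) (hδ : M.toBlocks₁₁.det ∉ P)
    (hΔ : ∀ j : Fin r, (M.submatrix id (Sum.map id fun _ : Unit => j)).det ∈ P)
    (e : Fin k ⊕ Unit → Fin k ⊕ Fin r) : (M.submatrix id e).det ∈ P := by
  -- Cramer's rule replaces the last column of `N`, so that column is free; this choice makes `N`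
  -- block triangular, with determinant the given minor.
  set N : Matrix (Fin k ⊕ Unit) (Fin k ⊕ Unit) A :=
    fromBlocks M.toBlocks₁₁ 0 M.toBlocks₂₁ 1 with hN
  have hupd : ∀ b : Fin k ⊕ Unit → A, ∀ i l, N.updateCol (Sum.inr ()) b i (Sum.inl l)
      = M i (Sum.inl l) := by
    rintro b (i | i) l <;> simp [hN, toBlocks₁₁, toBlocks₂₁]
  have hcol : ∀ c, N.cramer (fun i => M i c) (Sum.inr ()) ∈ P := by
    rintro (c | j)
    · rw [cramer_apply, det_zero_of_column_eq (i := Sum.inl c) (j := Sum.inr ()) (by simp)]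
      · exact P.zero_mem
      · intro i
        rw [hupd]
        simp
    · rw [cramer_apply]
      convert hΔ j using 2
      ext i (l | l)
      · rw [hupd]
        rfl
      · simp
  -- The cofactors along the last column: pairing `w` with a column `b` gives the determinant of the
  -- first `k` columns bordered by `b`.
  set w : Fin k ⊕ Unit → A := fun i => N.cramer (Pi.single i 1) (Sum.inr ()) with hw
  have hsum : ∀ b, N.cramer b (Sum.inr ()) = ∑ i, w i * b i := by
    intro b
    conv_lhs => rw [← Finset.univ_sum_single b]
    rw [map_sum, Finset.sum_apply]
    refine Finset.sum_congr rfl fun i _ => ?_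
    have : (Pi.single i (b i) : Fin k ⊕ Unit → A) = b i • Pi.single i 1 := by
      rw [← Pi.single_smul]
      simp
    rw [this, map_smul, Pi.smul_apply, smul_eq_mul, mul_comm]
  have hwlast : w (Sum.inr ()) = M.toBlocks₁₁.det := by
    have : N.updateCol (Sum.inr ()) (Pi.single (Sum.inr ()) 1) = N := by
      ext i (l | l)
      · simp
      · rcases i with i | i <;> simp [hN]
    change N.cramer (Pi.single (Sum.inr ()) 1) (Sum.inr ()) = _
    rw [cramer_apply, this, hN, det_fromBlocks_zero₁₂]
    simp
  -- Modulo `P`, `w` annihilates every column of `M`. Multiplying by the adjugate turns this into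
  -- the chosen minor times `w`, whose last entry is not in `P`.
  have hmem : (w ᵥ* M.submatrix id e ᵥ* (M.submatrix id e).adjugate) (Sum.inr ()) ∈ P := by
    change ∑ c, (w ᵥ* M.submatrix id e) c * (M.submatrix id e).adjugate c (Sum.inr ()) ∈ P
    refine P.sum_mem fun c _ => P.mul_mem_right _ ?_
    have := hcol (e c)
    rw [hsum] at this
    simpa [vecMul, dotProduct] using this
  rw [vecMul_vecMul, mul_adjugate] at hmem
  simp only [vecMul_smul, vecMul_one, Pi.smul_apply, smul_eq_mul, hwlast] at hmem
  exact (‹P.IsPrime›.mem_or_mem hmem).resolve_right hδ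

/-- A special case of the theorem of Eagon and Northcott on the height of determinantal ideals. -/
theorem height_le_of_forall_maximal_minors_mem [IsNoetherianRing A]
    (M : Matrix (Fin k ⊕ Unit) (Fin k ⊕ Fin r) A) (𝔭 : Ideal A) [𝔭.IsPrime]
    (hM : ∀ i j, M i j ∈ 𝔭)
    (h : ∀ Q : Ideal A, Q.IsPrime → Q ≤ 𝔭 →
      (∀ e : Fin k ⊕ Unit → Fin k ⊕ Fin r, (M.submatrix id e).det ∈ Q) → Q = 𝔭) :
    𝔭.height ≤ r := by
  -- Deform `M` so that its first `k × k` minor becomes `X ^ k` modulo `𝔭`. Away from this minor,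
  -- `r` bordered minors control all maximal minors, and Krull's height theorem applies.
  set E : Matrix (Fin k ⊕ Unit) (Fin k ⊕ Fin r) (Polynomial A) := fromBlocks 1 0 0 0 with hE
  set M' : Matrix (Fin k ⊕ Unit) (Fin k ⊕ Fin r) (Polynomial A) :=
    M.map Polynomial.C + (Polynomial.X : Polynomial A) • E with hM'
  set π := Polynomial.mapRingHom (Ideal.Quotient.mk 𝔭)
  have hπM : M'.map π = (Polynomial.X : Polynomial (A ⧸ 𝔭)) • fromBlocks 1 0 0 0 := by
    ext1 i j
    have : (Ideal.Quotient.mk 𝔭) (M i j) = 0 := Ideal.Quotient.eq_zero_iff_mem.2 (hM i j)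
    rcases i with i | i <;> rcases j with j | j
    · by_cases hij : i = j
      · subst hij
        simp [hM', hE, π, this]
      · simp [hM', hE, π, this, hij]
    all_goals simp [hM', hE, π, this]
  have hδ : M'.toBlocks₁₁.det ∉ 𝔭.map (Polynomial.C : A →+* Polynomial A) := by
    rw [Ideal.mem_map_polynomialC_iff_map_eq_zero, RingHom.map_det]
    have : π.mapMatrix M'.toBlocks₁₁ = (Polynomial.X : Polynomial (A ⧸ 𝔭)) • 1 := by
      ext1 i j
      have := congrFun (congrFun hπM (Sum.inl i)) (Sum.inl j)
      simpa [toBlocks₁₁] using this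
    rw [this]
    simp
  set Δ : Fin r → Polynomial A :=
    fun j => (M'.submatrix id (Sum.map id fun _ : Unit => j)).det with hΔ
  have hΔmem : ∀ j, Δ j ∈ 𝔭.map (Polynomial.C : A →+* Polynomial A) := by
    intro j
    rw [Ideal.mem_map_polynomialC_iff_map_eq_zero, hΔ, RingHom.map_det]
    refine det_eq_zero_of_row_eq_zero (Sum.inr ()) fun c => ?_
    have := congrFun (congrFun hπM (Sum.inr ())) (Sum.map id (fun _ => j) c)
    rcases c with c | c <;> simpa [π] using this
  have hprime : (𝔭.map (Polynomial.C : A →+* Polynomial A)).IsPrime := inferInstance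
  refine (Ideal.height_le_height_map_polynomialC 𝔭).trans ?_
  -- For a smaller prime `P` containing the bordered minors, all maximal minors lie in `P`.
  -- Specializing to `X = 0` shows that `𝔭 + (X)` is minimal over `P + (X)`. Since `𝔭A[X]` lies
  -- between `P` and `𝔭 + (X)`, strictly below the latter, it equals `P`.
  have hmin : 𝔭.map (Polynomial.C : A →+* Polynomial A) ∈
      (Ideal.span (Set.range Δ)).minimalPrimes := by
    refine ⟨⟨hprime, Ideal.span_le.2 (by rintro _ ⟨j, rfl⟩; exact hΔmem j)⟩, ?_⟩
    rintro P ⟨hP, hΔP⟩ hPle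
    have hδP : M'.toBlocks₁₁.det ∉ P := fun hc => hδ (hPle hc)
    have hall := det_submatrix_mem_of_bordered_minors_mem M' hδP
      fun j => hΔP (Ideal.subset_span ⟨j, rfl⟩)
    set ev : Polynomial A →+* A := Polynomial.evalRingHom 0
    have hlt : 𝔭.map (Polynomial.C : A →+* Polynomial A) < 𝔭.comap ev := by
      refine lt_iff_le_not_ge.2 ⟨Ideal.map_le_iff_le_comap.2 fun a ha => ?_, fun hle => ?_⟩
      · simpa [ev] using ha
      · have hX : (Polynomial.X : Polynomial A) ∈ 𝔭.comap ev := by simp [ev]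
        have := (Ideal.mem_map_C_iff.1 (hle hX)) 1
        rw [Polynomial.coeff_X_one] at this
        exact (Ideal.ne_top_iff_one 𝔭).1 (Ideal.IsPrime.ne_top inferInstance) this
    refine (Ideal.eq_of_lt_of_mem_minimalPrimes_sup_span_singleton
      (x := (Polynomial.X : Polynomial A)) hPle hlt ⟨⟨inferInstance, ?_⟩, ?_⟩).ge
    · refine sup_le (hPle.trans hlt.le) ?_
      rw [Ideal.span_singleton_le_iff_mem]
      simp [ev]
    · rintro Q ⟨hQ, hPQ⟩ hQle
      have hXQ : (Polynomial.X : Polynomial A) ∈ Q :=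
        hPQ (Ideal.mem_sup_right (Ideal.mem_span_singleton_self _))
      -- As `X ∈ Q`, membership in `Q` depends only on the constant term.
      have hev : ∀ f : Polynomial A, f ∈ Q ↔ Polynomial.C (ev f) ∈ Q := by
        intro f
        conv_lhs => rw [← Polynomial.divX_mul_X_add f]
        rw [Ideal.add_mem_iff_right _ (Q.mul_mem_left _ hXQ)]
        simp [ev, Polynomial.coeff_zero_eq_eval_zero]
      have hQ' : Q.comap Polynomial.C = 𝔭 := by
        refine h _ inferInstance (fun a ha => ?_) fun e => ?_
        · simpa [ev] using hQle ha
        · have h1 := hPQ (Ideal.mem_sup_left (hall e))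
          rw [hev, RingHom.map_det] at h1
          rw [Ideal.mem_comap]
          convert h1 using 3
          ext i j
          simp [hM', ev]
      intro f hf
      rw [hev, ← Ideal.mem_comap, hQ']
      exact hf
  refine (Ideal.height_le_card_of_mem_minimalPrimes_span (Set.finite_range Δ) hmin).trans ?_
  rw [← Set.image_univ]
  exact_mod_cast (Set.ncard_image_le (Set.toFinite _)).trans (by simp [Set.ncard_univ])

end Matrix
end

/-! ### Minors, directional derivatives and Jacobians -/

noncomputable section

namespace Matrix

variable {K : Type*} [Field K] {m n : Type*} [Fintype m] [DecidableEq m]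

/-- Linearly independent rows have a nonzero maximal minor. -/
theorem exists_submatrix_det_ne_zero [Finite n] (M : Matrix m n K) (hM : LinearIndependent K M.row) :
    ∃ e : m → n, (M.submatrix id e).det ≠ 0 := by
  have := Fintype.ofFinite n
  have hspan : Submodule.span K (Set.range M.col) = ⊤ := by
    apply Submodule.eq_top_of_finrank_eq
    rw [← rank_eq_finrank_span_cols, hM.rank_matrix]
    simp
  obtain ⟨κ, a, -, ha, hli⟩ := exists_linearIndependent' K M.col
  rw [hspan] at ha
  have b := (Module.Basis.mk hli ha.ge).indexEquiv (Pi.basisFun K m)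
  refine ⟨a ∘ b.symm, ?_⟩
  rw [← isUnit_iff_ne_zero, ← isUnit_iff_isUnit_det, ← linearIndependent_cols_iff_isUnit]
  exact hli.comp _ b.symm.injective

end Matrix

variable {N : ℕ}

/-- The derivative of polynomials in the direction of a constant vector. -/
def dirDeriv (u : Fin (N + 1) → ℂ) : Derivation ℂ (CoordRing N) (CoordRing N) :=
  ∑ i, u i • pderiv i

theorem dirDeriv_apply (u : Fin (N + 1) → ℂ) (f : CoordRing N) :
    dirDeriv u f = ∑ i, u i • pderiv i f := by
  change Derivation.coeFnAddMonoidHom (∑ i, u i • pderiv i) f = _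
  rw [map_sum, Finset.sum_apply]
  rfl

theorem dirDeriv_add (u w : Fin (N + 1) → ℂ) (f : CoordRing N) :
    dirDeriv (u + w) f = dirDeriv u f + dirDeriv w f := by
  simp [dirDeriv_apply, add_smul, Finset.sum_add_distrib]

theorem dirDeriv_smul (c : ℂ) (u : Fin (N + 1) → ℂ) (f : CoordRing N) :
    dirDeriv (c • u) f = c • dirDeriv u f := by
  simp [dirDeriv_apply, mul_smul, Finset.smul_sum]

theorem dirDeriv_X (u : Fin (N + 1) → ℂ) (i : Fin (N + 1)) : dirDeriv u (X i) = C (u i) := by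
  rw [dirDeriv_apply, Finset.sum_eq_single i]
  · simp [smul_eq_C_mul]
  · intro j _ hj
    simp [pderiv_X_of_ne hj.symm]
  · simp

theorem MvPolynomial.IsHomogeneous.dirDeriv {f : CoordRing N} {d : ℕ} (hf : f.IsHomogeneous d)
    (u : Fin (N + 1) → ℂ) : (dirDeriv u f).IsHomogeneous (d - 1) := by
  rw [dirDeriv_apply]
  refine IsHomogeneous.sum _ _ _ fun i _ => ?_
  rw [smul_eq_C_mul]
  exact hf.pderiv.C_mul _

theorem eval_dirDeriv_bind₁ {M : ℕ} (v u : Fin (M + 1) → ℂ) (F : Fin (N + 1) → CoordRing M)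
    (f : CoordRing N) :
    eval v (dirDeriv u (bind₁ F f)) =
      eval (fun j => eval v (F j)) (dirDeriv (fun j => eval v (dirDeriv u (F j))) f) := by
  have heval : ∀ g : CoordRing N, eval v (bind₁ F g) = eval (fun j => eval v (F j)) g := by
    intro g
    rw [← coe_aeval_eq_eval, ← coe_aeval_eq_eval]
    exact aeval_bind₁ _ _ _
  induction f using MvPolynomial.induction_on with
  | C a => simp [← algebraMap_eq]
  | add p q hp hq => simp only [map_add, hp, hq]
  | mul_X p i hp =>
    simp only [map_mul, Derivation.leibniz, map_add, smul_eq_mul, hp, bind₁_X_right, dirDeriv_X,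
      eval_X, eval_C, heval]

/-- The derivative at `v` of the map given by the polynomials `f`. -/
def jacobianMap {ι : Type*} (v : Fin (N + 1) → ℂ) (f : ι → CoordRing N) :
    (Fin (N + 1) → ℂ) →ₗ[ℂ] (ι → ℂ) where
  toFun u i := eval v (dirDeriv u (f i))
  map_add' u w := by
    ext i
    simp [dirDeriv_add]
  map_smul' c u := by
    ext i
    simp [dirDeriv_smul, smul_eval]

theorem jacobianMap_apply {ι : Type*} (v : Fin (N + 1) → ℂ) (f : ι → CoordRing N)
    (u : Fin (N + 1) → ℂ) (i : ι) : jacobianMap v f u i = eval v (dirDeriv u (f i)) := rfl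

theorem eval_dirDeriv_self {f : CoordRing N} {d : ℕ} (hf : f.IsHomogeneous d)
    (v : Fin (N + 1) → ℂ) : eval v (dirDeriv v f) = d * eval v f := by
  have := congrArg (eval v) hf.sum_X_mul_pderiv
  simpa [dirDeriv_apply, smul_eval] using this

theorem MvPolynomial.IsHomogeneous.eval_smul {f : CoordRing N} {d : ℕ} (hf : f.IsHomogeneous d)
    (c : ℂ) (v : Fin (N + 1) → ℂ) : eval (c • v) f = c ^ d * eval v f := by
  rw [eval_eq', eval_eq', Finset.mul_sum]
  refine Finset.sum_congr rfl fun m hm => ?_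
  have hdeg : ∑ i, m i = d := by
    rw [hf.degree_eq_sum_deg_support hm]
    exact (Finset.sum_subset (Finset.subset_univ _) (by simp)).symm
  simp only [Pi.smul_apply, smul_eq_mul, mul_pow, Finset.prod_mul_distrib,
    Finset.prod_pow_eq_pow_sum, hdeg]
  ring

theorem MvPolynomial.IsHomogeneous.eval_rep_mk_eq_zero_iff {f : CoordRing N} {d : ℕ}
    (hf : f.IsHomogeneous d) {v : Fin (N + 1) → ℂ} (hv : v ≠ 0) :
    eval (Projectivization.mk ℂ v hv).rep f = 0 ↔ eval v f = 0 := by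
  obtain ⟨a, ha⟩ := Projectivization.exists_smul_eq_mk_rep ℂ v hv
  rw [← ha, Units.smul_def, hf.eval_smul]
  simp

/-! ### Homogeneous ideals and irreducible closed sets -/

/-- The homogeneous polynomials that vanish on `X`. -/
def homogVanishing (X : Set (ProjSpace N)) : Set (CoordRing N) :=
  {f | (∃ d, f.IsHomogeneous d) ∧ ∀ p ∈ X, eval p.rep f = 0}

theorem homogVanishingIdeal_eq_span (X : Set (ProjSpace N)) :
    homogVanishingIdeal X = Ideal.span (homogVanishing X) := rfl

theorem homogVanishing_anti {X Y : Set (ProjSpace N)} (h : X ⊆ Y) :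
    homogVanishing Y ⊆ homogVanishing X :=
  fun _ hf => ⟨hf.1, fun p hp => hf.2 p (h hp)⟩

theorem eval_eq_zero_of_mem_homogVanishingIdeal {X : Set (ProjSpace N)} {f : CoordRing N}
    (hf : f ∈ homogVanishingIdeal X) {v : Fin (N + 1) → ℂ} (hv : v ≠ 0)
    (hvX : Projectivization.mk ℂ v hv ∈ X) : eval v f = 0 := by
  have : homogVanishingIdeal X ≤ RingHom.ker (eval v) := by
    refine Ideal.span_le.2 fun g hg => ?_
    obtain ⟨⟨d, hd⟩, hg⟩ := hg
    exact (hd.eval_rep_mk_eq_zero_iff hv).1 (hg _ hvX)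
  exact this hf

theorem eval_rep_eq_zero_of_mem_homogVanishingIdeal {X : Set (ProjSpace N)} {f : CoordRing N}
    (hf : f ∈ homogVanishingIdeal X) {p : ProjSpace N} (hp : p ∈ X) : eval p.rep f = 0 :=
  eval_eq_zero_of_mem_homogVanishingIdeal hf p.rep_nonzero (by rwa [p.mk_rep])

theorem isClosed_iff_isProjAlgebraic {X : Set (ProjSpace N)} :
    IsClosed X ↔ IsProjAlgebraic X := by
  rw [← isOpen_compl_iff]
  change Xᶜᶜ ∈ {X | IsProjAlgebraic X} ↔ _
  rw [compl_compl]
  rfl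

theorem IsClosed.mem_of_forall_homogVanishing {X : Set (ProjSpace N)} (hX : IsClosed X)
    {p : ProjSpace N} (hp : ∀ f ∈ homogVanishing X, eval p.rep f = 0) : p ∈ X := by
  obtain ⟨S, hS, hXS⟩ := isClosed_iff_isProjAlgebraic.1 hX
  rw [hXS]
  refine fun f hf => hp f ⟨hS f hf, fun q hq => ?_⟩
  rw [hXS] at hq
  exact hq f hf

theorem isClosed_setOf_eval_rep_eq_zero {f : CoordRing N} {d : ℕ} (hf : f.IsHomogeneous d) :
    IsClosed {p : ProjSpace N | eval p.rep f = 0} := by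
  refine isClosed_iff_isProjAlgebraic.2 ⟨{f}, ?_, ?_⟩
  · rintro _ rfl
    exact ⟨d, hf⟩
  · ext p
    simp [projZeroLocus]

attribute [local instance] MvPolynomial.gradedAlgebra

/-- Primality of a homogeneous ideal can be tested on homogeneous elements, where it says that `Z`
is not covered by two closed sets neither of which contains it. -/
theorem isPrime_homogVanishingIdeal {Z : Set (ProjSpace N)} (hZ : IsIrreducible Z) :
    (homogVanishingIdeal Z).IsPrime := by
  refine Ideal.IsHomogeneous.isPrime_of_homogeneous_mem_or_mem
    (𝒜 := homogeneousSubmodule (Fin (N + 1)) ℂ) ?_ ?_ ?_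
  · exact Ideal.homogeneous_span _ _ fun f hf => hf.1
  · intro h
    obtain ⟨p, hp⟩ := hZ.nonempty
    have := eval_rep_eq_zero_of_mem_homogVanishingIdeal ((Ideal.eq_top_iff_one _).1 h) hp
    simp at this
  · rintro f g ⟨a, hf⟩ ⟨b, hg⟩ hfg
    have hsub : Z ⊆ {p | eval p.rep f = 0} ∪ {p | eval p.rep g = 0} := by
      intro p hp
      have := eval_rep_eq_zero_of_mem_homogVanishingIdeal hfg hp
      rw [map_mul] at this
      exact mul_eq_zero.1 this
    rcases isPreirreducible_iff_isClosed_union_isClosed.1 hZ.isPreirreducible _ _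
      (isClosed_setOf_eval_rep_eq_zero hf) (isClosed_setOf_eval_rep_eq_zero hg) hsub with h | h
    · exact Or.inl (Ideal.subset_span ⟨⟨a, hf⟩, h⟩)
    · exact Or.inr (Ideal.subset_span ⟨⟨b, hg⟩, h⟩)

theorem homogVanishingIdeal_lt_of_lt {Z W : TopologicalSpace.IrreducibleCloseds (ProjSpace N)}
    (h : Z < W) :
    homogVanishingIdeal (W : Set (ProjSpace N)) < homogVanishingIdeal (Z : Set (ProjSpace N)) := by
  obtain ⟨hle, hnle⟩ := lt_iff_le_not_ge.1 h
  refine lt_iff_le_not_ge.2 ⟨Ideal.span_mono (homogVanishing_anti hle), fun hI => hnle ?_⟩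
  exact fun p hp => Z.isClosed.mem_of_forall_homogVanishing fun f hf =>
    eval_rep_eq_zero_of_mem_homogVanishingIdeal (hI (Ideal.subset_span hf)) hp

/-! ### Affine tangent spaces -/

/-- The affine cone over the embedded tangent space of `X` at the point represented by `v`. -/
def coneTangent (X : Set (ProjSpace N)) (v : Fin (N + 1) → ℂ) :
    Submodule ℂ (Fin (N + 1) → ℂ) where
  carrier := {u | ∀ f ∈ homogVanishing X, eval v (dirDeriv u f) = 0}
  zero_mem' := fun f _ => by simp [dirDeriv_apply]
  add_mem' := fun hu hw f hf => by rw [dirDeriv_add, map_add, hu f hf, hw f hf, add_zero]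
  smul_mem' := fun c u hu f hf => by rw [dirDeriv_smul, smul_eval, hu f hf, mul_zero]

theorem mem_coneTangent {X : Set (ProjSpace N)} {v u : Fin (N + 1) → ℂ} :
    u ∈ coneTangent X v ↔ ∀ f ∈ homogVanishing X, eval v (dirDeriv u f) = 0 := Iff.rfl

theorem coneTangent_smul (X : Set (ProjSpace N)) {c : ℂ} (hc : c ≠ 0) (v : Fin (N + 1) → ℂ) :
    coneTangent X (c • v) = coneTangent X v := by
  ext u
  refine forall₂_congr fun f hf => ?_
  obtain ⟨⟨d, hd⟩, -⟩ := hf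
  rw [(hd.dirDeriv u).eval_smul]
  simp [hc]

/-- Homogeneous generators suffice: in the product rule for `c * f`, the term containing `f(p)`
vanishes because `p ∈ X`. -/
theorem tangentSubmodule_eq_coneTangent {X : Set (ProjSpace N)} {p : ProjSpace N} (hp : p ∈ X) :
    tangentSubmodule X p = coneTangent X p.rep := by
  have hker : ∀ f u, u ∈ LinearMap.ker (∑ i, eval p.rep (pderiv i f) •
      (LinearMap.proj i : (Fin (N + 1) → ℂ) →ₗ[ℂ] ℂ)) ↔ eval p.rep (dirDeriv u f) = 0 := by
    intro f u
    simp [dirDeriv_apply, smul_eval, mul_comm]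
  ext u
  simp only [tangentSubmodule, Submodule.mem_iInf, hker]
  refine ⟨fun h f hf => h f (Ideal.subset_span hf), fun h f hf => ?_⟩
  rw [homogVanishingIdeal_eq_span] at hf
  induction hf using Submodule.span_induction with
  | mem f hf => exact h f hf
  | zero => simp
  | add f g _ _ hf hg => simp [hf, hg]
  | smul c f hfI hf =>
    have := eval_rep_eq_zero_of_mem_homogVanishingIdeal hfI hp
    simp [hf, this]

theorem tangentSubmodule_mk {X : Set (ProjSpace N)} {v : Fin (N + 1) → ℂ} (hv : v ≠ 0)
    (hvX : Projectivization.mk ℂ v hv ∈ X) :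
    tangentSubmodule X (Projectivization.mk ℂ v hv) = coneTangent X v := by
  obtain ⟨a, ha⟩ := Projectivization.exists_smul_eq_mk_rep ℂ v hv
  rw [tangentSubmodule_eq_coneTangent hvX, ← ha, Units.smul_def, coneTangent_smul X a.ne_zero]

theorem self_mem_coneTangent {X : Set (ProjSpace N)} {v : Fin (N + 1) → ℂ} (hv : v ≠ 0)
    (hvX : Projectivization.mk ℂ v hv ∈ X) : v ∈ coneTangent X v := by
  intro f hf
  obtain ⟨⟨d, hd⟩, hf⟩ := hf
  rw [eval_dirDeriv_self hd, (hd.eval_rep_mk_eq_zero_iff hv).1 (hf _ hvX), mul_zero]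

end

/-! ### Embeddings preserve tangent dimensions -/

noncomputable section

variable {M N : ℕ}

theorem IsRegularMap.continuous {X : Set (ProjSpace M)} {φ : X → ProjSpace N}
    (hφ : IsRegularMap X φ) : Continuous φ := by
  refine continuous_iff_continuousAt.2 fun x => ?_
  obtain ⟨U, hU, hxU, d, F, hF, hφF⟩ := hφ x
  refine ContinuousOn.continuousAt ?_ (hU.mem_nhds hxU)
  refine continuousOn_iff_isClosed.2 fun T hT => ?_
  obtain ⟨S, hS, rfl⟩ := isClosed_iff_isProjAlgebraic.1 hT
  refine ⟨Subtype.val ⁻¹' projZeroLocus {g | ∃ f ∈ S, g = bind₁ F f}, ?_, ?_⟩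
  · refine IsClosed.preimage continuous_subtype_val (isClosed_iff_isProjAlgebraic.2 ⟨_, ?_, rfl⟩)
    rintro _ ⟨f, hf, rfl⟩
    obtain ⟨a, ha⟩ := hS f hf
    exact ⟨_, ha.aeval F hF⟩
  · ext y
    refine and_congr_left fun hy => ?_
    obtain ⟨h, hy⟩ := hφF y hy
    have key : ∀ f ∈ S, (eval (φ y).rep f = 0 ↔ eval (y : ProjSpace M).rep (bind₁ F f) = 0) := by
      intro f hf
      obtain ⟨a, ha⟩ := hS f hf
      rw [hy, ha.eval_rep_mk_eq_zero_iff, ← coe_aeval_eq_eval, ← coe_aeval_eq_eval]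
      exact Eq.congr_left (aeval_bind₁ _ _ _).symm
    constructor
    · rintro hyS _ ⟨f, hf, rfl⟩
      exact (key f hf).1 (hyS f hf)
    · exact fun hyS f hf => (key f hf).2 (hyS _ ⟨f, hf, rfl⟩)

theorem IsProjEmbedding.isClosedEmbedding {X : Set (ProjSpace M)} {φ : X → ProjSpace N}
    (hφ : IsProjEmbedding X φ) : Topology.IsClosedEmbedding φ := by
  obtain ⟨ψ, hψ, hψφ⟩ := hφ.exists_inverse
  have hψφ' : ∀ x : X, ψ ⟨φ x, Set.mem_range_self x⟩ = x := hψφ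
  refine .of_continuous_injective_isClosedMap hφ.regular.continuous ?_ ?_
  · intro x y hxy
    apply Subtype.ext
    rw [← hψφ' x, ← hψφ' y]
    congr 1
    exact Subtype.ext hxy
  · intro C hC
    obtain ⟨D, hD, rfl⟩ := isClosed_induced_iff.1 hC
    have : φ '' (Subtype.val ⁻¹' D) = Subtype.val '' (ψ ⁻¹' D) := by
      ext y
      constructor
      · rintro ⟨x, hx, rfl⟩
        exact ⟨⟨φ x, Set.mem_range_self x⟩, by simpa [hψφ'] using hx, rfl⟩
      · rintro ⟨⟨_, x, rfl⟩, hx, rfl⟩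
        exact ⟨x, by simpa [hψφ'] using hx, rfl⟩
    rw [this]
    exact hφ.isClosed_range.isClosedEmbedding_subtypeVal.isClosedMap _
      (hD.preimage hψ.continuous)

/-- An open neighbourhood in a subset of projective space contains the nonvanishing locus of
a homogeneous polynomial. -/
theorem exists_isHomogeneous_of_isOpen {X : Set (ProjSpace M)} {W : Set X} (hW : IsOpen W) {x : X}
    (hx : x ∈ W) : ∃ (a : ℕ) (h : CoordRing M), h.IsHomogeneous a ∧
      eval (x : ProjSpace M).rep h ≠ 0 ∧ ∀ y : X, y ∉ W → eval (y : ProjSpace M).rep h = 0 := by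
  obtain ⟨V, hV, rfl⟩ := isOpen_induced_iff.1 hW
  by_contra! hcon
  refine hV.isClosed_compl.mem_of_forall_homogVanishing (p := x) (fun h hh => ?_) hx
  obtain ⟨⟨a, ha⟩, hh⟩ := hh
  by_contra hne
  obtain ⟨y, hy, hne'⟩ := hcon a h ha hne
  exact hne' (hh _ hy)

/-- Linear algebra for the derivative `D` of a homogeneous lift, where Euler's formula gives `D v =
c • w` with `c` the degree. For `c = 0` the map `D` kills `v`; the correction along `w` in `L` gives
`L v = w` and makes `L` injective on `S` in every case. -/
theorem finrank_le_of_map_eq_smul_imp {E F : Type*} [AddCommGroup E] [Module ℂ E] [AddCommGroup F]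
    [Module ℂ F] [Module.Finite ℂ F] (D : E →ₗ[ℂ] F) (v : E) (w : F) (c : ℂ) (ℓ : E →ₗ[ℂ] ℂ)
    (S : Submodule ℂ E) (T : Submodule ℂ F) (hℓ : ℓ v = 1) (hw : w ≠ 0) (hwT : w ∈ T)
    (hD : D v = c • w) (hST : ∀ u ∈ S, D u ∈ T)
    (hker : ∀ u ∈ S, ∀ b : ℂ, D u = b • w → ∃ a : ℂ, u = a • v) :
    Module.finrank ℂ S ≤ Module.finrank ℂ T := by
  set L : E →ₗ[ℂ] F := D + (ℓ.smulRight w) - c • ℓ.smulRight w with hL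
  have hLapp : ∀ u, L u = D u + ℓ u • w - c • ℓ u • w := fun u => by simp [hL]
  have hLT : ∀ u ∈ S, L u ∈ T := fun u hu => by
    rw [hLapp]
    exact T.sub_mem (T.add_mem (hST u hu) (T.smul_mem _ hwT)) (T.smul_mem _ (T.smul_mem _ hwT))
  refine LinearMap.finrank_le_finrank_of_injective (f := L.restrict hLT) ?_
  rw [injective_iff_map_eq_zero]
  rintro ⟨u, hu⟩ h0
  have h0 : D u + ℓ u • w - c • ℓ u • w = 0 := by
    rw [← hLapp]
    exact congrArg Subtype.val h0
  obtain ⟨a, rfl⟩ := hker u hu (c * ℓ u - ℓ u) (by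
    rw [sub_smul, mul_smul, eq_sub_iff_add_eq]
    exact sub_eq_zero.1 h0)
  have : a • w = 0 := by
    simp only [map_smul, hD, hℓ, smul_eq_mul, mul_one] at h0
    rw [← h0, smul_comm]
    abel
  have ha : a = 0 := (smul_eq_zero.1 this).resolve_right hw
  simp [ha]

/-- A regular map with a regular left inverse does not decrease dimensions of tangent spaces. -/
theorem finrank_tangentSubmodule_le {X : Set (ProjSpace M)} {Y : Set (ProjSpace N)}
    {φ : X → ProjSpace N} {ψ : Y → ProjSpace M} (hφ : IsRegularMap X φ) (hψ : IsRegularMap Y ψ)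
    (hφY : ∀ x, φ x ∈ Y) (hψφ : ∀ x : X, ψ ⟨φ x, hφY x⟩ = x) (x : X) :
    Module.finrank ℂ (tangentSubmodule X x) ≤ Module.finrank ℂ (tangentSubmodule Y (φ x)) := by
  obtain ⟨U, hU, hxU, d, F, hF, hφF⟩ := hφ x
  obtain ⟨V, hV, hxV, e, G, hG, hψG⟩ := hψ ⟨φ x, hφY x⟩
  have hcont : Continuous fun y : X => (⟨φ y, hφY y⟩ : Y) := hφ.continuous.subtype_mk _
  obtain ⟨a, h, hha, hhx, hhW⟩ := exists_isHomogeneous_of_isOpen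
    (W := U ∩ (fun y : X => (⟨φ y, hφY y⟩ : Y)) ⁻¹' V) (hU.inter (hV.preimage hcont)) ⟨hxU, hxV⟩
  have heval : ∀ v (g : CoordRing N), eval v (bind₁ F g) = eval (fun j => eval v (F j)) g := by
    intro v g
    rw [← coe_aeval_eq_eval, ← coe_aeval_eq_eval]
    exact aeval_bind₁ _ _ _
  -- A polynomial vanishing only on the neighbourhood becomes an equation of `X` after
  -- multiplication by `h`; as `h` is nonzero at `x`, the product rule removes it again.
  have hder : ∀ (k : ℕ) (g : CoordRing M), g.IsHomogeneous k →
      (∀ y ∈ U ∩ (fun y : X => (⟨φ y, hφY y⟩ : Y)) ⁻¹' V, eval (y : ProjSpace M).rep g = 0) →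
      ∀ u ∈ coneTangent X (x : ProjSpace M).rep,
        eval (x : ProjSpace M).rep (dirDeriv u g) = 0 := by
    intro k g hg hgW u hu
    have hmem : h * g ∈ homogVanishing X := by
      refine ⟨⟨_, hha.mul hg⟩, fun p hp => ?_⟩
      rw [map_mul]
      by_cases hpW : (⟨p, hp⟩ : X) ∈ U ∩ (fun y : X => (⟨φ y, hφY y⟩ : Y)) ⁻¹' V
      · rw [hgW _ hpW, mul_zero]
      · rw [hhW _ hpW, zero_mul]
    have h1 := hu _ hmem
    rw [Derivation.leibniz] at h1
    simpa [hgW x ⟨hxU, hxV⟩, hhx] using h1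
  set v := (x : ProjSpace M).rep with hv
  obtain ⟨hw0, hφx⟩ := hφF x hxU
  set w : Fin (N + 1) → ℂ := fun i => eval v (F i) with hw
  have hwY : Projectivization.mk ℂ w hw0 ∈ Y := hφx ▸ hφY x
  have hX : tangentSubmodule X x = coneTangent X v := tangentSubmodule_eq_coneTangent x.2
  have hY : tangentSubmodule Y (φ x) = coneTangent Y w := by
    rw [hφx]
    exact tangentSubmodule_mk hw0 hwY
  rw [hX, hY]
  set D := jacobianMap v F with hD
  have hDapp : ∀ u j, D u j = eval v (dirDeriv u (F j)) := fun _ _ => rfl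
  have hDv : D v = (d : ℂ) • w := by
    ext j
    rw [hDapp, eval_dirDeriv_self (hF j)]
    rfl
  have hv0 : v ≠ 0 := (x : ProjSpace M).rep_nonzero
  obtain ⟨i₀, hi₀⟩ := Function.ne_iff.1 hv0
  refine finrank_le_of_map_eq_smul_imp D v w d ((v i₀)⁻¹ • LinearMap.proj i₀) _ _
    (by simpa using inv_mul_cancel₀ hi₀) hw0 (self_mem_coneTangent hw0 hwY) hDv ?_ ?_
  · rintro u hu f ⟨⟨k, hk⟩, hf⟩
    have := hder _ (bind₁ F f) (hk.aeval F hF) (fun y hy => ?_) u hu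
    · rw [eval_dirDeriv_bind₁] at this
      exact this
    · obtain ⟨hy0, hφy⟩ := hφF y hy.1
      rw [heval]
      have h1 := hf _ (hφY y)
      rwa [hφy, hk.eval_rep_mk_eq_zero_iff] at h1
  · intro u hu b hb
    obtain ⟨hG0, -⟩ := hψG _ hxV
    -- The left inverse makes `G ∘ F` proportional to the identity near `x`; differentiating the
    -- resulting `2 × 2` minors along `u` bounds the kernel of `D` modulo `w`.
    have hpar : ∀ y ∈ U ∩ (fun y : X => (⟨φ y, hφY y⟩ : Y)) ⁻¹' V, ∃ c : ℂ, c ≠ 0 ∧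
        ∀ i, eval (y : ProjSpace M).rep (bind₁ F (G i)) = c * (y : ProjSpace M).rep i := by
      intro y hy
      obtain ⟨hy0, hφy⟩ := hφF y hy.1
      obtain ⟨hz0, hψy⟩ := hψG _ hy.2
      obtain ⟨s, hs⟩ := Projectivization.exists_smul_eq_mk_rep ℂ _ hy0
      obtain ⟨t, ht⟩ := Projectivization.exists_smul_eq_mk_rep ℂ _ hz0
      rw [← hψy, hψφ] at ht
      refine ⟨(t : ℂ)⁻¹ * ((s : ℂ) ^ e)⁻¹, by simp, fun i => ?_⟩
      have h1 := congrFun ht i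
      simp only [Pi.smul_apply, Units.smul_def, smul_eq_mul] at h1
      rw [hφy, ← hs, Units.smul_def, (hG i).eval_smul, ← heval] at h1
      rw [← h1]
      have := s.ne_zero
      have := t.ne_zero
      field_simp
    obtain ⟨c, hc, hcG⟩ := hpar x ⟨hxU, hxV⟩
    have hGw : ∀ i, eval w (G i) = c * v i := fun i => by rw [← hcG, heval]
    have hrel : ∀ i j, b * e * (c * v i) * v j + (c * v i) * u j
        - (b * e * (c * v j) * v i + (c * v j) * u i) = 0 := by
      intro i j
      have hhom : (bind₁ F (G i) * MvPolynomial.X j - bind₁ F (G j) * MvPolynomial.X i).IsHomogeneous (d * e + 1) :=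
        (((hG i).aeval F hF).mul (isHomogeneous_X _ _)).sub
          (((hG j).aeval F hF).mul (isHomogeneous_X _ _))
      have h1 := hder _ _ hhom (fun y hy => ?_) u hu
      · have h2 : ∀ i, eval v (dirDeriv u (bind₁ F (G i))) = b * e * (c * v i) := by
          intro i
          rw [eval_dirDeriv_bind₁]
          change eval w (dirDeriv (D u) (G i)) = _
          rw [hb, dirDeriv_smul, smul_eval, eval_dirDeriv_self (hG i), hGw]
          ring
        rw [map_sub, Derivation.leibniz, Derivation.leibniz, dirDeriv_X, dirDeriv_X] at h1
        simp only [map_sub, map_add, smul_eq_mul, map_mul, h2, heval, eval_X, eval_C] at h1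
        have h3 : ∀ i, eval (fun j => eval v (F j)) (G i) = c * v i := hGw
        rw [h3, h3] at h1
        linear_combination h1
      · obtain ⟨c', -, hc'⟩ := hpar y hy
        rw [map_sub, map_mul, map_mul, hc', hc', eval_X, eval_X]
        ring
    refine ⟨u i₀ * (v i₀)⁻¹, ?_⟩
    ext j
    have hi₀' : v i₀ ≠ 0 := hi₀
    have h4 := hrel i₀ j
    have h5 : c * (v i₀ * u j - v j * u i₀) = 0 := by linear_combination h4
    have h6 : v i₀ * u j - v j * u i₀ = 0 := (mul_eq_zero.1 h5).resolve_left hc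
    rw [Pi.smul_apply, smul_eq_mul]
    field_simp
    linear_combination h6

theorem IsProjEmbedding.finrank_tangentSubmodule_eq {X : Set (ProjSpace M)} {φ : X → ProjSpace N}
    (hφ : IsProjEmbedding X φ) (x : X) :
    Module.finrank ℂ (tangentSubmodule (Set.range φ) (φ x)) =
      Module.finrank ℂ (tangentSubmodule X x) := by
  obtain ⟨ψ, hψ, hψφ⟩ := hφ.exists_inverse
  have hψX : ∀ y, ψ y ∈ X := by
    rintro ⟨_, z, rfl⟩
    exact (hψφ z : ψ ⟨φ z, _⟩ = z) ▸ z.2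
  refine le_antisymm ?_ (finrank_tangentSubmodule_le hφ.regular hψ Set.mem_range_self hψφ x)
  have := finrank_tangentSubmodule_le hψ hφ.regular hψX (fun y => ?_) ⟨φ x, Set.mem_range_self x⟩
  · rwa [hψφ x] at this
  · obtain ⟨_, z, rfl⟩ := y
    congr 1
    exact Subtype.ext (hψφ z)

/-! ### Local equations and the upper bound on height -/

theorem finrank_ker_jacobianMap {q : ℕ} (v : Fin (N + 1) → ℂ) (f : Fin q → CoordRing N)
    (e : Fin q → Fin (N + 1))
    (hdet : (Matrix.of fun i k => eval v (pderiv (e k) (f i))).det ≠ 0) :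
    Module.finrank ℂ (LinearMap.ker (jacobianMap v f)) + q = N + 1 := by
  set G : Matrix (Fin q) (Fin q) ℂ := Matrix.of fun i k => eval v (pderiv (e k) (f i)) with hG
  have hcol : ∀ k i, jacobianMap v f (Pi.single (e k) 1) i = G i k := by
    intro k i
    rw [jacobianMap_apply, dirDeriv_apply, Finset.sum_eq_single (e k)]
    · simp [hG]
    · intro j _ hj
      simp [hj]
    · simp
  have hsurj : LinearMap.range (jacobianMap v f) = ⊤ := by
    refine LinearMap.range_eq_top.2 fun b => ⟨∑ k, (G⁻¹.mulVec b) k • Pi.single (e k) 1, ?_⟩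
    ext i
    have h1 : G.mulVec (G⁻¹.mulVec b) = b := by
      rw [Matrix.mulVec_mulVec, Matrix.mul_nonsing_inv _ (isUnit_iff_ne_zero.2 hdet),
        Matrix.one_mulVec]
    conv_rhs => rw [← h1]
    rw [map_sum, Finset.sum_apply, Matrix.mulVec, dotProduct]
    refine Finset.sum_congr rfl fun k _ => ?_
    rw [map_smul, Pi.smul_apply, hcol, smul_eq_mul, mul_comm]
  have := LinearMap.finrank_range_add_finrank_ker (jacobianMap v f)
  rw [hsurj, finrank_top, Module.finrank_fin_fun, Module.finrank_fin_fun] at this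
  omega

/-- Finitely many equations cut out the tangent space at a point, with a nonzero Jacobian minor. -/
theorem exists_ker_jacobianMap_eq_coneTangent (Y : Set (ProjSpace N)) (v : Fin (N + 1) → ℂ) :
    ∃ (q : ℕ) (f : Fin q → CoordRing N) (e : Fin q → Fin (N + 1)),
      (∀ i, f i ∈ homogVanishing Y) ∧
      (Matrix.of fun i k => eval v (pderiv (e k) (f i))).det ≠ 0 ∧
      LinearMap.ker (jacobianMap v f) = coneTangent Y v := by
  set grad : CoordRing N → (Fin (N + 1) → ℂ) := fun f c => eval v (pderiv c f) with hgrad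
  -- Equations whose gradients at `v` form a basis of the span of all gradients.
  obtain ⟨g, hg, hspan, hli⟩ := Submodule.exists_fun_fin_finrank_span_eq ℂ
    (grad '' homogVanishing Y)
  choose f hf hfg using hg
  obtain ⟨e, he⟩ := Matrix.exists_submatrix_det_ne_zero (Matrix.of g) hli
  have hdot : ∀ u f, eval v (dirDeriv u f) = grad f ⬝ᵥ u := by
    intro u f
    simp [dirDeriv_apply, smul_eval, dotProduct, hgrad, mul_comm]
  refine ⟨_, f, e, hf, ?_, ?_⟩
  · have : (Matrix.of fun i k => eval v (pderiv (e k) (f i))) = (Matrix.of g).submatrix id e := by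
      ext i k
      exact congrFun (hfg i) (e k)
    rwa [this]
  · ext u
    constructor
    · intro hu
      have hall : ∀ w ∈ Submodule.span ℂ (grad '' homogVanishing Y), w ⬝ᵥ u = 0 := by
        intro w hw
        rw [← hspan] at hw
        induction hw using Submodule.span_induction with
        | mem w hw =>
          obtain ⟨i, rfl⟩ := hw
          rw [← hfg, ← hdot]
          exact congrFun hu i
        | zero => simp
        | add w w' _ _ h h' => rw [add_dotProduct, h, h', add_zero]
        | smul c w _ h => rw [smul_dotProduct, h, smul_zero]
      intro h hh
      rw [hdot]
      exact hall _ (Submodule.subset_span ⟨h, hh, rfl⟩)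
    · intro hu
      ext i
      exact hu _ (hf i)

theorem IsSkew.disjoint_tangentSubmodule {Y : Set (ProjSpace N)} (hY : IsSkew Y) {x y : ProjSpace N}
    (hx : x ∈ Y) (hy : y ∈ Y) (hxy : x ≠ y) :
    Disjoint (tangentSubmodule Y x) (tangentSubmodule Y y) := by
  rw [Submodule.disjoint_def]
  intro u hux huy
  by_contra hu
  have hle : ∀ T : Submodule ℂ (Fin (N + 1) → ℂ), u ∈ T →
      (Projectivization.mk ℂ u hu).submodule ≤ T := fun T hT => by
    rwa [Projectivization.submodule_mk, Submodule.span_singleton_le_iff_mem]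
  have : Projectivization.mk ℂ u hu ∈ embeddedTangentSpace Y x ∩ embeddedTangentSpace Y y :=
    ⟨hle _ hux, hle _ huy⟩
  rw [hY x hx y hy hxy] at this
  exact this

/-- Hilbert's Nullstellensatz for a prime, hence radical, ideal. -/
theorem exists_eval_ne_zero_of_notMem {Q : Ideal (CoordRing N)} [Q.IsPrime] {g : CoordRing N}
    (hg : g ∉ Q) : ∃ v : Fin (N + 1) → ℂ, (∀ f ∈ Q, eval v f = 0) ∧ eval v g ≠ 0 := by
  rw [← IsPrime.vanishingIdeal_zeroLocus (K := ℂ) Q, mem_vanishingIdeal_iff] at hg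
  push Not at hg
  obtain ⟨v, hv, hgv⟩ := hg
  exact ⟨v, fun f hf => by simpa [aeval_eq_eval] using hv f hf, by simpa [aeval_eq_eval] using hgv⟩

/-- The local ring of a skew `n`-dimensional subset of `ℙ^N` at a point has dimension at most
`N - 2 * n`. -/
theorem IsSkew.height_le {n r : ℕ} (hN : N = 2 * n + r) {Y : Set (ProjSpace N)} (hY : IsClosed Y)
    (hskew : IsSkew Y) (hdim : ∀ y ∈ Y, Module.finrank ℂ (tangentSubmodule Y y) = n + 1)
    {p : ProjSpace N} (hp : p ∈ Y) :
    ((homogVanishingIdeal {p}).map (Ideal.Quotient.mk (homogVanishingIdeal Y))).height ≤ r := by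
  set I := homogVanishingIdeal Y with hI
  set 𝔭 := homogVanishingIdeal {p} with h𝔭
  have hIp : I ≤ 𝔭 := Ideal.span_mono (homogVanishing_anti (Set.singleton_subset_iff.2 hp))
  have h𝔭prime : 𝔭.IsPrime := isPrime_homogVanishingIdeal isIrreducible_singleton
  have hTp := tangentSubmodule_eq_coneTangent hp
  have hdimp := hdim p hp
  rw [hTp] at hdimp
  obtain ⟨q, f, e, hf, hdet, hker⟩ := exists_ker_jacobianMap_eq_coneTangent Y p.rep
  have hq : q = n + r := by
    have := finrank_ker_jacobianMap p.rep f e hdet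
    rw [hker, hdimp] at this
    omega
  subst hq
  set h : CoordRing N := (Matrix.of fun i k => pderiv (e k) (f i)).det with hh
  have hheval : ∀ v, eval v h = (Matrix.of fun i k => eval v (pderiv (e k) (f i))).det := by
    intro v
    rw [hh, RingHom.map_det]
    rfl
  have b := (Module.finBasis ℂ (coneTangent Y p.rep)).reindex
    (Fintype.equivOfCardEq (β := Fin n ⊕ Unit) (by simp [hdimp]))
  set D : Matrix (Fin n ⊕ Unit) (Fin n ⊕ Fin r) (CoordRing N) :=
    Matrix.of fun a j => dirDeriv (b a : Fin (N + 1) → ℂ) (f (finSumFinEquiv j)) with hD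
  have hsurj := Ideal.Quotient.mk_surjective (I := I)
  have hprime' : (𝔭.map (Ideal.Quotient.mk I)).IsPrime :=
    Ideal.map_isPrime_of_surjective hsurj (by rwa [Ideal.mk_ker])
  -- The entries of `D` vanish at `p` since each `b a` is tangent there. It remains to see that the
  -- minors define nothing larger than the line over `p`, locally at `p`.
  refine Matrix.height_le_of_forall_maximal_minors_mem (D.map (Ideal.Quotient.mk I)) _ ?_ ?_
  · intro a j
    refine Ideal.mem_map_of_mem _ (Ideal.subset_span ?_)
    obtain ⟨d, hd⟩ := (hf (finSumFinEquiv j)).1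
    refine ⟨⟨_, hd.dirDeriv _⟩, ?_⟩
    rintro _ rfl
    exact (b a).2 _ (hf _)
  · intro Q' hQ' hQ'le hminors
    set Q := Q'.comap (Ideal.Quotient.mk I) with hQ
    have hIQ : I ≤ Q := fun g hg => by
      rw [hQ, Ideal.mem_comap, Ideal.Quotient.eq_zero_iff_mem.2 hg]
      exact Q'.zero_mem
    have hQle : Q ≤ 𝔭 := by
      refine (Ideal.comap_mono hQ'le).trans ?_
      rw [Ideal.comap_map_of_surjective' _ hsurj, Ideal.mk_ker, sup_eq_left.2 hIp]
    rw [← Ideal.map_comap_of_surjective _ hsurj Q', ← hQ]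
    congr 1
    refine le_antisymm hQle fun g hg => ?_
    by_contra hgQ
    have hnotMem : ∀ {g'}, eval p.rep g' ≠ 0 → g' ∉ Q := fun hg' hmem =>
      hg' (eval_rep_eq_zero_of_mem_homogVanishingIdeal (hQle hmem) rfl)
    obtain ⟨i₀, hi₀⟩ := Function.ne_iff.1 p.rep_nonzero
    -- A zero `v` of `Q` outside this product represents a point other than `p` (by `g`), with
    -- nonzero Jacobian minor (by `h`), and is not the vertex of the cone (by `X i₀`).
    have hprod : g * (h * MvPolynomial.X i₀) ∉ Q := by
      have hQprime : Q.IsPrime := inferInstance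
      refine fun hmem => (hQprime.mem_or_mem hmem).elim hgQ (hnotMem ?_)
      rw [map_mul, eval_X, hheval]
      exact mul_ne_zero hdet hi₀
    obtain ⟨v, hvQ, hv⟩ := exists_eval_ne_zero_of_notMem hprod
    rw [map_mul, map_mul, eval_X] at hv
    obtain ⟨hgv, hv⟩ := mul_ne_zero_iff.1 hv
    obtain ⟨hhv, hvi⟩ := mul_ne_zero_iff.1 hv
    have hv0 : v ≠ 0 := Function.ne_iff.2 ⟨i₀, hvi⟩
    have hvY : Projectivization.mk ℂ v hv0 ∈ Y := hY.mem_of_forall_homogVanishing fun g' hg' => by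
      obtain ⟨d, hd⟩ := hg'.1
      exact (hd.eval_rep_mk_eq_zero_iff hv0).2 (hvQ _ (hIQ (Ideal.subset_span hg')))
    have hvp : p ≠ Projectivization.mk ℂ v hv0 := fun heq =>
      hgv (eval_eq_zero_of_mem_homogVanishingIdeal hg hv0 heq.symm)
    have hTv := tangentSubmodule_mk hv0 hvY
    -- One inclusion is clear; both sides have dimension `n + 1`, as the Jacobian minor is nonzero
    -- at `v`.
    have hkerv : coneTangent Y v = LinearMap.ker (jacobianMap v f) := by
      refine Submodule.eq_of_le_of_finrank_eq (fun u hu => ?_) ?_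
      · ext i
        exact hu _ (hf i)
      · have h1 := finrank_ker_jacobianMap v f e (by rwa [← hheval])
        have h2 := hdim _ hvY
        rw [hTv] at h2
        omega
    have hdep : ¬ LinearIndependent ℂ (D.map (eval v)).row := by
      intro hli
      obtain ⟨c, hc⟩ := Matrix.exists_submatrix_det_ne_zero _ hli
      refine hc ?_
      have h1 : (D.submatrix id c).det ∈ Q := by
        have := hminors c
        rw [hQ, Ideal.mem_comap, RingHom.map_det]
        exact this
      have h2 := hvQ _ h1
      rw [RingHom.map_det] at h2
      exact h2
    obtain ⟨w, hw, a, hwa⟩ := Fintype.not_linearIndependent_iff.1 hdep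
    -- A relation among the rows at `v` is a vector tangent at `p` that the Jacobian at `v` kills,
    -- so it is tangent at both points.
    set u := ∑ a, w a • b a with hu
    have huv : (u : Fin (N + 1) → ℂ) ∈ coneTangent Y v := by
      rw [hkerv, LinearMap.mem_ker, hu, Submodule.coe_sum, map_sum]
      ext i
      have h1 := congrFun hw (finSumFinEquiv.symm i)
      rw [Finset.sum_apply] at h1 ⊢
      refine (Finset.sum_congr rfl fun a _ => ?_).trans h1
      rw [Submodule.coe_smul, map_smul]
      simp [hD, jacobianMap_apply]
    have hdisj := hskew.disjoint_tangentSubmodule hp hvY hvp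
    rw [hTp, hTv, Submodule.disjoint_def] at hdisj
    have hu0 : u = 0 := Subtype.ext (hdisj _ u.2 huv)
    exact hwa (Fintype.linearIndependent_iff.1 b.linearIndependent w hu0 a)

/-! ### Chains of subvarieties and the final inequality -/

/-- Vanishing ideals reverse the chain into primes of the coordinate ring of `Y`, the largest of
which lies in the ideal of `p`. -/
theorem le_height_of_ltSeries {Y : Set (ProjSpace N)}
    (c : LTSeries (TopologicalSpace.IrreducibleCloseds (ProjSpace N)))
    (hc : ∀ i, (c i : Set (ProjSpace N)) ⊆ Y) {p : ProjSpace N} (hp : p ∈ c 0) :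
    (c.length : ℕ∞) ≤
      ((homogVanishingIdeal {p}).map (Ideal.Quotient.mk (homogVanishingIdeal Y))).height := by
  set I := homogVanishingIdeal Y with hI
  have hsurj := Ideal.Quotient.mk_surjective (I := I)
  have hle : ∀ i, I ≤ homogVanishingIdeal (c i : Set (ProjSpace N)) := fun i =>
    Ideal.span_mono (homogVanishing_anti (hc i))
  have hprime : ∀ i, ((homogVanishingIdeal (c i : Set (ProjSpace N))).map
      (Ideal.Quotient.mk I)).IsPrime := fun i =>
    have := isPrime_homogVanishingIdeal (c i).isIrreducible
    Ideal.map_isPrime_of_surjective hsurj (by rw [Ideal.mk_ker]; exact hle i)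
  have hmono : StrictMono fun i : Fin (c.length + 1) =>
      (⟨_, hprime i.rev⟩ : PrimeSpectrum (CoordRing N ⧸ I)) := by
    intro i j hij
    have hlt := homogVanishingIdeal_lt_of_lt (c.strictMono (Fin.rev_lt_rev.2 hij))
    change Ideal.map _ _ < Ideal.map _ _
    refine lt_of_le_of_ne (Ideal.map_mono hlt.le) fun h => hlt.ne ?_
    have h' := congrArg (Ideal.comap (Ideal.Quotient.mk I)) h
    rwa [Ideal.comap_map_of_surjective' _ hsurj, Ideal.comap_map_of_surjective' _ hsurj,
      Ideal.mk_ker, sup_eq_left.2 (hle _), sup_eq_left.2 (hle _)] at h'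
  have := Order.length_le_height_last (p := LTSeries.mk c.length _ hmono)
  rw [← PrimeSpectrum.height_eq_orderHeight] at this
  refine this.trans (Ideal.height_mono (Ideal.map_mono (Ideal.span_mono (homogVanishing_anti ?_))))
  rw [Set.singleton_subset_iff]
  change p ∈ c (Fin.last c.length).rev
  rwa [Fin.rev_last]

theorem IsSmoothProjectiveVariety.exists_ltSeries {n : ℕ} {X : Set (ProjSpace M)}
    (hX : IsSmoothProjectiveVariety n X) {φ : X → ProjSpace N} (hφ : IsProjEmbedding X φ) :
    ∃ c : LTSeries (TopologicalSpace.IrreducibleCloseds (ProjSpace N)), c.length = n ∧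
      ∀ i, (c i : Set (ProjSpace N)) ⊆ Set.range φ := by
  obtain ⟨x, hx⟩ := hX.nonempty
  have hZ := hX.dim_component _ (irreducibleComponent_mem_irreducibleComponents (⟨x, hx⟩ : X))
  obtain ⟨c, hc⟩ := Order.le_krullDim_iff.1 hZ.ge
  have hind : Topology.IsInducing fun z : irreducibleComponent (⟨x, hx⟩ : X) => φ z :=
    hφ.isClosedEmbedding.isInducing.comp Topology.IsInducing.subtypeVal
  refine ⟨c.map _ (TopologicalSpace.IrreducibleCloseds.map_strictMono_of_isInducing hind), hc,
    fun i => ?_⟩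
  refine closure_minimal ?_ hφ.isClosed_range
  rintro _ ⟨z, -, rfl⟩
  exact Set.mem_range_self _

theorem three_mul_le_of_isSkew {n : ℕ} {X : Set (ProjSpace M)}
    (hX : IsSmoothProjectiveVariety n X) {φ : X → ProjSpace N} (hφ : IsProjEmbedding X φ)
    (hskew : IsSkew (Set.range φ)) : 3 * n ≤ N := by
  obtain ⟨c, rfl, hc⟩ := hX.exists_ltSeries hφ
  obtain ⟨p, hp⟩ := (c 0).isIrreducible.nonempty
  have hdim : ∀ y ∈ Set.range φ,
      Module.finrank ℂ (tangentSubmodule (Set.range φ) y) = c.length + 1 := by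
    rintro _ ⟨x, rfl⟩
    rw [hφ.finrank_tangentSubmodule_eq, hX.smooth x x.2]
  rcases le_or_gt (2 * c.length) N with hN | hN
  · obtain ⟨r, hr⟩ := Nat.exists_eq_add_of_le hN
    have h1 := (le_height_of_ltSeries c hc hp).trans
      (hskew.height_le hr hφ.isClosed_range hdim (hc _ hp))
    have h2 : c.length ≤ r := by exact_mod_cast h1
    omega
  -- Here `c.length` is positive, so the chain provides a second point; two disjoint subspaces of
  -- dimension `c.length + 1` do not fit into `ℂ^(N+1)`.
  · have hlt : c 0 < c (Fin.last _) := c.strictMono (Fin.lt_def.2 (by simp; omega))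
    obtain ⟨y, hy, hyp⟩ := Set.not_subset.1 (lt_iff_le_not_ge.1 hlt).2
    have hpy : p ≠ y := fun h => hyp (h ▸ hp)
    have h1 := Submodule.finrank_add_finrank_le_of_disjoint
      (hskew.disjoint_tangentSubmodule (hc _ hp) (hc _ hy) hpy)
    rw [hdim _ (hc _ hp), hdim _ (hc _ hy), Module.finrank_fin_fun] at h1
    omega

end

theorem mainTheorem5 {M n : ℕ} (X : Set (ProjSpace M)) (hX : IsSmoothProjectiveVariety n X) :
    ((3 * n : ℕ) : ℕ∞) ≤ msdim n X ∧
      ∀ (N : ℕ) (φ : X → ProjSpace N),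
        IsProjEmbedding X φ → IsSkew (Set.range φ) → 3 * n ≤ N := by
  refine ⟨le_sInf ?_, fun N φ hφ hskew => three_mul_le_of_isSkew hX hφ hskew⟩
  rintro _ ⟨N, φ, rfl, hφ, hskew⟩
  exact_mod_cast three_mul_le_of_isSkew hX hφ hskew.isSkew
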